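/- **Setting.** Let the vocabulary be $[V]=\{1,\dots,V\}$ with $V\ge 2$, and let an autoregressive language model $p$ assign to each finite string a probability distribution on $[V]$. A key is a pair $\xi=(\pi,u)$; its law $\nu$ makes $\pi$ a uniformly random permutation of $[V]$ and $u\sim\mathrm{Unif}[0,1]$ independent of $\pi$. Consider a sequence of detection problems with $n\to\infty$; the quantities $m,B,n_0,T$, the law of the prompt, the transformation $\mathcal T$ and the weights may change along the sequence, and $1\le B\le\min(n,m)$. In each of them, the prompt $y_{-n_0:0}$ is a random (or deterministic) string, independent of the keys $\xi_1,\dots,\xi_n$, which are i.i.d. with law $\nu$. With $\mu_i=p(\cdot\mid y_{-n_0:i-1})$, inverse transform sampling (ITS) generates, for $i=1,\dots,n$, $$y_i=\pi_i^{-1}\bigl(\min\{\pi_i(l):\mu_i(\{j:\pi_i(j)\le\pi_i(l)\})\ge u_i\}\bigr).$$ The published text is $\widetilde y_{1:m}=\mathcal T(y_{-n_0:n})$ for a function $\mathcal T$, and $w_1,\dots,w_n\ge 0$ are weights, which may be functions of $y_{-n_0:n}$. For $1\le a\le n-B+1$ and $1\le b\le m-B+1$ put $$\phi(\xi_{a:a+B-1},\widetilde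 y_{b:b+B-1})=\frac1B\sum_{i=0}^{B-1}w_{a+i}\Bigl(u_{a+i}-\frac12\Bigr)\Bigl(\frac{\pi_{a+i}(\widetilde y_{b+i})-1}{V-1}-\frac12\Bigr),$$ $$\mathcal M(\xi_{1:n},\widetilde y_{1:m})=\max_{a,b}\phi(\xi_{a:a+B-1},\widetilde y_{b:b+B-1}).$$ Let $\xi^{(1)}_{1:n},\dots,\xi^{(T)}_{1:n}$ be independent key sequences with i.i.d. entries of law $\nu$, independent of the prompt and of $\xi_{1:n}$, and let $$\mathsf p_T=\frac1{T+1}\Bigl(1+\sum_{t=1}^T\mathbf 1\{\mathcal M(\xi_{1:n},\widetilde y_{1:m})\le\mathcal M(\xi^{(t)}_{1:n},\widetilde y_{1:m})\}\Bigr)$$ (the same weights being used for every key sequence). Put $N=\max\{n,m\}$, $\Omega_{\max}=\max_{1\le i\le n}w_i^2$, $C_{N,B}=\sqrt{\Omega_{\max}}\sqrt{\log(N)/B}$ and $\mathcal F_m=\sigma(y_{-n_0:0},\widetilde y_{1:m})$. **Theorem.** There is an absolute constant $C_0>0$ such that for every level $\alpha\in(0,1)$ and every $\epsilon>0$ there is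 a constant $C_1>0$ depending only on $\alpha$ and $\epsilon$, with $C_1=C_0$ whenever $3\epsilon<\alpha$, for which the following holds. If $T>2/\epsilon-1$ throughout and $$C_{N,B}^{-1}\max_{a,b}\mathbb E\bigl[\phi(\xi_{a:a+B-1},\widetilde y_{b:b+B-1})\,\big|\,\widetilde y_{1:m},y_{-n_0:n}\bigr]\to+\infty$$ in probability (where the left side is read as $0$ if $C_{N,B}=0$), then the randomization test that rejects when $\mathsf p_T\le\alpha$ satisfies $$P(\mathsf p_T\le\alpha\mid\mathcal F_m)\ge 1-C_1\exp(-2T\epsilon^2)+o(1),$$ where $o(1)$ denotes a term that tends to $0$ in probability; that is, for every $\delta>0$ the probability that the left side is smaller than $1-C_1\exp(-2T\epsilon^2)-\delta$ tends to $0$. -/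

import Mathlib

open MeasureTheory ProbabilityTheory Filter Topology

noncomputable section

namespace ITSWatermark

/-- Permutations of the vocabulary carry the discrete sigma-algebra. -/
instance instMeasurableSpacePerm (V : ℕ) : MeasurableSpace (Equiv.Perm (Fin V)) := ⊤

/-- A watermark key `ξ = (π, u)`: a permutation of the vocabulary and a number in `[0,1]`.
The vocabulary of size `V` is `Fin V`, so ranks run over `0, …, V - 1`. -/
abbrev Key (V : ℕ) : Type := Equiv.Perm (Fin V) × unitInterval

/-- The key law `ν`: `π` uniform on all permutations, `u` uniform on `[0,1]`, independent. -/
def keyLaw (V : ℕ) : Measure (Key V) :=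
  (PMF.uniformOfFintype (Equiv.Perm (Fin V))).toMeasure.prod volume

/-- An autoregressive language model: a string (oldest token first) is mapped to the
distribution of the next token. -/
abbrev LanguageModel (V : ℕ) : Type := List (Fin V) → PMF (Fin V)

/-- `μ(j : π(j) ≤ r)`. -/
def rankCDF {V : ℕ} (π : Equiv.Perm (Fin V)) (μ : PMF (Fin V)) (r : Fin V) : ℝ :=
  ∑ j ∈ Finset.univ.filter (fun j => π j ≤ r), (μ j).toReal

open Classical in
/-- The set `{π(l) : μ(j : π(j) ≤ π(l)) ≥ u}`. -/
def admissibleRanks {V : ℕ} (ξ : Key V) (μ : PMF (Fin V)) : Finset (Fin V) :=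
  (Finset.univ.filter (fun l => (ξ.2 : ℝ) ≤ rankCDF ξ.1 μ (ξ.1 l))).image ξ.1

theorem admissibleRanks_nonempty {V : ℕ} (ξ : Key V) (μ : PMF (Fin V)) :
    (admissibleRanks ξ μ).Nonempty := by
  classical
  obtain ⟨k, -⟩ := μ.support_nonempty
  have : NeZero V := ⟨fun h => by subst h; exact k.elim0⟩
  refine Finset.Nonempty.image ⟨ξ.1.symm ⊤, ?_⟩ _
  have hsum : rankCDF ξ.1 μ ⊤ = 1 := by
    have h1 : ∑ j, μ j = 1 := by
      rw [← tsum_fintype (L := .unconditional _)]; exact μ.tsum_coe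
    unfold rankCDF
    rw [Finset.filter_true_of_mem (fun j _ => le_top),
      ← ENNReal.toReal_sum (fun j _ => μ.apply_ne_top j), h1, ENNReal.toReal_one]
  simp only [Finset.mem_filter, Finset.mem_univ, true_and, Equiv.apply_symm_apply, hsum]
  exact ξ.2.2.2

/-- The decoder
`Γ((π, u), μ) = π⁻¹ (min {π(l) : μ(j : π(j) ≤ π(l)) ≥ u})`. -/
def decode {V : ℕ} (ξ : Key V) (μ : PMF (Fin V)) : Fin V :=
  ξ.1.symm ((admissibleRanks ξ μ).min' (admissibleRanks_nonempty ξ μ))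

/-- The watermarked text: `y_i = Γ(ξ_i, p(· | prompt, y_1, …, y_{i-1}))`. -/
def generate {V n : ℕ} (p : LanguageModel V) (prompt : List (Fin V)) (ξ : Fin n → Key V)
    (i : Fin n) : Fin V :=
  decode (ξ i) (p (prompt ++
    List.ofFn (fun j : Fin i.val => generate p prompt ξ ⟨j.val, j.isLt.trans i.isLt⟩)))
termination_by i.val
decreasing_by exact j.isLt

/-- The segment of length `B` that starts at position `a`. -/
def window {α : Type*} {n B : ℕ} (hB : B ≤ n) (a : Fin (n - B + 1)) (f : Fin n → α) :
    Fin B → α :=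
  fun i => f ⟨a.val + i.val, by have := a.isLt; have := i.isLt; omega⟩

/-- The weighted statistic of a key segment and a text segment of length `B`,
`φ = B⁻¹ ∑ w_i (u_i - 1/2) (rank_i / (V - 1) - 1/2)`, where `rank_i = π_i(y_i)` is counted
from `0`. -/
def weightedStat {V B : ℕ} (w : Fin B → ℝ) (ξ : Fin B → Key V) (y : Fin B → Fin V) : ℝ :=
  1 / (B : ℝ) * ∑ i, w i * (((ξ i).2 : ℝ) - 1 / 2) *
    ((((ξ i).1 (y i)).val : ℝ) / ((V : ℝ) - 1) - 1 / 2)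

/-- One detection problem over the vocabulary `Fin V`. -/
structure Experiment (V : ℕ) where
  /-- length of the key and of the generated text -/
  n : ℕ
  /-- length of the published text -/
  m : ℕ
  /-- window length -/
  B : ℕ
  /-- the prompt is `y_{-n₀}, …, y_0` -/
  n₀ : ℕ
  /-- number of randomly drawn key sequences in the randomization test -/
  T : ℕ
  one_le_B : 1 ≤ B
  B_le_n : B ≤ n
  B_le_m : B ≤ m
  /-- law of the prompt (a point mass for a deterministic prompt) -/
  promptLaw : PMF (Fin (n₀ + 1) → Fin V)
  /-- the transformation that turns the generated text into the published text -/
  edit : (Fin (n₀ + 1) → Fin V) → (Fin n → Fin V) → (Fin m → Fin V)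
  /-- the weights `w_1, …, w_n`; like `(1 - p_i) / p_i` they may depend on prompt and text -/
  weight : (Fin (n₀ + 1) → Fin V) → (Fin n → Fin V) → (Fin n → ℝ)
  weight_nonneg : ∀ x y i, 0 ≤ weight x y i

namespace Experiment

variable {V : ℕ} (E : Experiment V)

/-- Outcomes: the prompt, the key sequence `ξ`, and the `T` fresh key sequences `ξ^(t)`. -/
abbrev Sample : Type :=
  (Fin (E.n₀ + 1) → Fin V) × (Fin E.n → Key V) × (Fin E.T → Fin E.n → Key V)

/-- The prompt and all keys are independent, and every key has law `ν`. -/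
def prob : Measure E.Sample :=
  E.promptLaw.toMeasure.prod
    ((Measure.pi fun _ => keyLaw V).prod (Measure.pi fun _ => Measure.pi fun _ => keyLaw V))

/-- The generated text `y_{1:n}`. -/
def text (p : LanguageModel V) (ω : E.Sample) : Fin E.n → Fin V :=
  generate p (List.ofFn ω.1) ω.2.1

/-- The published text `ỹ_{1:m}`. -/
def published (p : LanguageModel V) (ω : E.Sample) : Fin E.m → Fin V :=
  E.edit ω.1 (E.text p ω)

/-- The realized weights. -/
def weights (p : LanguageModel V) (ω : E.Sample) : Fin E.n → ℝ :=
  E.weight ω.1 (E.text p ω)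

/-- `φ(ξ_{a:a+B-1}, ỹ_{b:b+B-1}; w_{a:a+B-1})`. -/
def windowStat (w : Fin E.n → ℝ) (ξ : Fin E.n → Key V) (y : Fin E.m → Fin V)
    (a : Fin (E.n - E.B + 1)) (b : Fin (E.m - E.B + 1)) : ℝ :=
  weightedStat (window E.B_le_n a w) (window E.B_le_n a ξ) (window E.B_le_m b y)

/-- The scanning maximum statistic. -/
def maxStat (w : Fin E.n → ℝ) (ξ : Fin E.n → Key V) (y : Fin E.m → Fin V) : ℝ :=
  Finset.univ.sup' Finset.univ_nonempty
    (fun ab : Fin (E.n - E.B + 1) × Fin (E.m - E.B + 1) => E.windowStat w ξ y ab.1 ab.2)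

open Classical in
/-- The randomization p-value. -/
def pValue (p : LanguageModel V) (ω : E.Sample) : ℝ :=
  1 / ((E.T : ℝ) + 1) * (1 + ∑ t : Fin E.T,
    if E.maxStat (E.weights p ω) ω.2.1 (E.published p ω)
        ≤ E.maxStat (E.weights p ω) (ω.2.2 t) (E.published p ω) then (1 : ℝ) else 0)

theorem univ_nonempty_n : (Finset.univ : Finset (Fin E.n)).Nonempty :=
  ⟨⟨0, E.one_le_B.trans E.B_le_n⟩, Finset.mem_univ _⟩

/-- `Ω_max = max_i w_i²`. -/
def omegaMax (p : LanguageModel V) (ω : E.Sample) : ℝ :=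
  Finset.univ.sup' E.univ_nonempty_n (fun i => E.weights p ω i ^ 2)

/-- `C_{N,B} = √Ω_max √(log N / B)` with `N = max n m`. -/
def scale (p : LanguageModel V) (ω : E.Sample) : ℝ :=
  √(E.omegaMax p ω) * √(Real.log ((max E.n E.m : ℕ) : ℝ) / (E.B : ℝ))

/-- The sigma-algebra of the published text, the prompt and the generated text. -/
abbrev fullInfo (p : LanguageModel V) : MeasurableSpace E.Sample :=
  MeasurableSpace.comap (fun ω => (E.published p ω, ω.1, E.text p ω)) ⊤

/-- The sigma-algebra `F_m` of the prompt and the published text. -/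
abbrev publicInfo (p : LanguageModel V) : MeasurableSpace E.Sample :=
  MeasurableSpace.comap (fun ω => (ω.1, E.published p ω)) ⊤

/-- `max_{a,b} E[φ(ξ_{a:a+B-1}, ỹ_{b:b+B-1}) | ỹ_{1:m}, y_{-n₀:n}]`. -/
def maxCondMean (p : LanguageModel V) (ω : E.Sample) : ℝ :=
  Finset.univ.sup' Finset.univ_nonempty
    (fun ab : Fin (E.n - E.B + 1) × Fin (E.m - E.B + 1) =>
      (E.prob[fun ω' => E.windowStat (E.weights p ω') ω'.2.1 (E.published p ω') ab.1 ab.2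
        | E.fullInfo p]) ω)

/-- The conditional power `P(p_T ≤ α | F_m)`. -/
def condPower (p : LanguageModel V) (α : ℝ) : E.Sample → ℝ :=
  E.prob⟦{ω | E.pValue p ω ≤ α}|E.publicInfo p⟧

end Experiment

end ITSWatermark

end

noncomputable section

/-! Fix the prompt and the generated text. Given the text, token `i` restricts key `i` alone, so the
event is a box in key space: conditionally on it the true keys stay independent
(`prob_atom_inter_key`), while each fresh sequence keeps its i.i.d. law (`prob_atom_inter_fresh`).
Published text and weights are then constants, and every window statistic is an average of
independent bounded terms.

Let `s` be the scale. Hoeffding's inequality at deviation `s` has failure probability `N⁻⁸`. If the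
largest conditional mean exceeds `2s`, the true statistic at that window exceeds `s` up to this
error. Fresh scores are centred, so by a union bound over at most `N²` windows a fresh maximum
reaches `s` with probability at most `N² · N⁻⁸`. Summing over texts, each fresh sequence beats the
true one with vanishing probability (`prob_exceedEvent_le`).

Markov's inequality for the number of exceedances, and again for the conditional probability, makes
the conditional power tend to one whenever `T + 1 ≥ 2 / α`. The term `C₁ exp(-2Tε²)` only serves to
make the claim trivial for smaller `T`. -/

namespace ITSWatermark

/-! ### Token scores and Hoeffding's inequality -/

/-- The contribution `(u - 1/2) (π(v) / (V - 1) - 1/2)` of one key and one token. -/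
def tokenScore {V : ℕ} (v : Fin V) (ξ : Key V) : ℝ :=
  ((ξ.2 : ℝ) - 1 / 2) * (((ξ.1 v).val : ℝ) / ((V : ℝ) - 1) - 1 / 2)

theorem weightedStat_eq {V B : ℕ} (w : Fin B → ℝ) (ξ : Fin B → Key V) (y : Fin B → Fin V) :
    weightedStat w ξ y = 1 / (B : ℝ) * ∑ i, w i * tokenScore (y i) (ξ i) := by
  simp only [weightedStat, tokenScore, mul_assoc]

instance instDiscretePerm (V : ℕ) : DiscreteMeasurableSpace (Equiv.Perm (Fin V)) :=
  ⟨fun _ => trivial⟩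

theorem measurable_tokenScore_comp {V : ℕ} {Ω : Type*} [MeasurableSpace Ω] {y : Ω → Fin V}
    {ξ : Ω → Key V} (hy : Measurable y) (hξ : Measurable ξ) :
    Measurable fun ω => tokenScore (y ω) (ξ ω) := by
  have hrank : Measurable fun q : Equiv.Perm (Fin V) × Fin V => ((q.1 q.2).val : ℝ) :=
    measurable_of_countable _
  have := hrank.comp (hξ.fst.prodMk hy)
  have hu : Measurable fun ω => ((ξ ω).2 : ℝ) := measurable_subtype_coe.comp hξ.snd
  exact (hu.sub_const _).mul ((this.div_const _).sub_const _)

theorem abs_tokenScore_le {V : ℕ} (hV : 2 ≤ V) (v : Fin V) (ξ : Key V) :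
    |tokenScore v ξ| ≤ 1 / 4 := by
  have hu : |(ξ.2 : ℝ) - 1 / 2| ≤ 1 / 2 := by
    rw [abs_le]; constructor <;> linarith [ξ.2.2.1, ξ.2.2.2]
  have hr : |((ξ.1 v).val : ℝ) / ((V : ℝ) - 1) - 1 / 2| ≤ 1 / 2 := by
    have h2 : (2 : ℝ) ≤ V := by exact_mod_cast hV
    have h1 : ((ξ.1 v).val : ℝ) + 1 ≤ V := by exact_mod_cast (ξ.1 v).isLt
    have h3 : ((ξ.1 v).val : ℝ) / ((V : ℝ) - 1) ≤ 1 := by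
      rw [div_le_one (by linarith)]; linarith
    have h4 : 0 ≤ ((ξ.1 v).val : ℝ) / ((V : ℝ) - 1) :=
      div_nonneg (Nat.cast_nonneg _) (by linarith)
    rw [abs_le]; constructor <;> linarith
  rw [tokenScore, abs_mul]
  calc _ ≤ (1 / 2 : ℝ) * (1 / 2) := mul_le_mul hu hr (abs_nonneg _) (by norm_num)
    _ = 1 / 4 := by norm_num

instance instIsProbabilityMeasureKeyLaw (V : ℕ) : IsProbabilityMeasure (keyLaw V) := by
  unfold keyLaw; infer_instance

/-- Under `ν` the two factors are independent and the factor in `u` is centred, so the law of the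
rank does not matter. -/
theorem integral_tokenScore_keyLaw {V : ℕ} (v : Fin V) :
    ∫ ξ, tokenScore v ξ ∂keyLaw V = 0 := by
  have hu : ∫ u : unitInterval, ((u : ℝ) - 1 / 2) = 0 := by
    rw [unitInterval.volume_def,
      integral_subtype_comap measurableSet_Icc (fun u : ℝ => u - 1 / 2),
      integral_Icc_eq_integral_Ioc, ← intervalIntegral.integral_of_le zero_le_one]
    simp
  have := integral_prod_mul (μ := (PMF.uniformOfFintype (Equiv.Perm (Fin V))).toMeasure)
    (ν := (volume : Measure unitInterval))
    (fun π => ((π v).val : ℝ) / ((V : ℝ) - 1) - 1 / 2) (fun u => (u : ℝ) - 1 / 2)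
  rw [hu, mul_zero] at this
  rw [← this, keyLaw]
  simp only [tokenScore, mul_comm]

/-- Hoeffding's inequality for the weighted statistic of a window of independent keys. -/
theorem weightedStat_tail {V n B : ℕ} (hV : 2 ≤ V) (hB : 1 ≤ B) (hBn : B ≤ n)
    (μ : Fin n → Measure (Key V)) [∀ i, IsProbabilityMeasure (μ i)] (w : Fin n → ℝ)
    {W : ℝ} (hW : 0 < W) (hw : ∀ i, w i ^ 2 ≤ W) (y : Fin B → Fin V) (a : Fin (n - B + 1))
    {s : ℝ} (hs : 0 ≤ s) :
    (Measure.pi μ).real {ξ | (∫ ξ', weightedStat (window hBn a w) (window hBn a ξ') y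
        ∂Measure.pi μ) + s ≤ weightedStat (window hBn a w) (window hBn a ξ) y}
      ≤ Real.exp (-(8 * B * s ^ 2 / W)) := by
  have hB0 : (0 : ℝ) < B := by exact_mod_cast hB
  let g : Fin B → Fin n := fun i => ⟨a.val + i.val, by have := a.isLt; have := i.isLt; omega⟩
  have hg : g.Injective := fun i j hij => by
    apply Fin.ext; simpa [g] using hij
  let X : Fin B → (Fin n → Key V) → ℝ := fun i ξ => w (g i) * tokenScore (y i) (ξ (g i))
  have hXm : ∀ i, Measurable (X i) := fun i =>
    (measurable_tokenScore_comp measurable_const (measurable_pi_apply (g i))).const_mul _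
  have hXb : ∀ i ξ, X i ξ ∈ Set.Icc (-(√W / 4)) (√W / 4) := fun i ξ => by
    rw [Set.mem_Icc, ← abs_le, abs_mul]
    have h1 : |w (g i)| ≤ √W := Real.abs_le_sqrt (hw _)
    calc _ ≤ √W * (1 / 4) := mul_le_mul h1 (abs_tokenScore_le hV _ _) (abs_nonneg _)
          (Real.sqrt_nonneg _)
      _ = √W / 4 := by ring
  have hind0 : iIndepFun (fun i (ξ : Fin n → Key V) => ξ i) (Measure.pi μ) :=
    iIndepFun_pi (X := fun _ ξ => ξ) (fun _ => aemeasurable_id)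
  have hind : iIndepFun (fun i ξ => X i ξ - (Measure.pi μ)[X i]) (Measure.pi μ) :=
    (hind0.precomp hg).comp
      (fun i k => w (g i) * tokenScore (y i) k - ∫ ξ, X i ξ ∂Measure.pi μ)
      (fun i => ((measurable_tokenScore_comp measurable_const measurable_id).const_mul _).sub_const _)
  have hsub := fun i => hasSubgaussianMGF_of_mem_Icc (μ := Measure.pi μ)
    (hXm i).aemeasurable (ae_of_all _ (hXb i))
  have hint : ∀ i, Integrable (X i) (Measure.pi μ) := fun i =>
    Integrable.of_mem_Icc _ _ (hXm i).aemeasurable (ae_of_all _ (hXb i))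
  have key := HasSubgaussianMGF.measure_sum_ge_le_of_iIndepFun hind
    (s := Finset.univ) (fun i _ => hsub i) (ε := B * s) (by positivity)
  have hstat : ∀ ξ, weightedStat (window hBn a w) (window hBn a ξ) y = 1 / (B : ℝ) * ∑ i, X i ξ :=
    fun ξ => weightedStat_eq _ _ _
  have hset : {ξ | (∫ ξ', weightedStat (window hBn a w) (window hBn a ξ') y
        ∂Measure.pi μ) + s ≤ weightedStat (window hBn a w) (window hBn a ξ) y}
      = {ξ | (B : ℝ) * s ≤ ∑ i, (X i ξ - (Measure.pi μ)[X i])} := by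
    ext ξ
    simp only [Set.mem_ofPred_eq, hstat]
    rw [integral_const_mul, integral_finsetSum _ (fun i _ => hint i), Finset.sum_sub_distrib,
      div_mul_eq_mul_div, div_mul_eq_mul_div, one_mul, one_mul, ← le_sub_iff_add_le', ← sub_div,
      le_div_iff₀ hB0, mul_comm]
  rw [hset]
  refine key.trans (le_of_eq ?_)
  congr 1
  -- Each summand lies in an interval of length `√W / 2`, hence has variance proxy `W / 16`; the
  -- exponent is `(B s)² / (2 B W / 16) = 8 B s² / W`.
  have hc : ((‖√W / 4 - -(√W / 4)‖₊ / 2 : NNReal) : ℝ) ^ 2 = W / 16 := by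
    rw [NNReal.coe_div, coe_nnnorm, Real.norm_eq_abs, sub_neg_eq_add,
      abs_of_nonneg (by positivity)]
    have := Real.sq_sqrt hW.le
    push_cast
    nlinarith
  rw [NNReal.coe_sum]
  simp only [NNReal.coe_pow, hc, Finset.sum_const, Finset.card_univ, Fintype.card_fin,
    nsmul_eq_mul]
  field_simp
  ring

/-! ### Texts as boxes in key space -/

theorem decode_eq_iff {V : ℕ} (ξ : Key V) (μ : PMF (Fin V)) (v : Fin V) :
    decode ξ μ = v ↔ (ξ.2 : ℝ) ≤ rankCDF ξ.1 μ (ξ.1 v) ∧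
      ∀ l, (ξ.2 : ℝ) ≤ rankCDF ξ.1 μ (ξ.1 l) → ξ.1 v ≤ ξ.1 l := by
  have hmem : ∀ l, ξ.1 l ∈ admissibleRanks ξ μ ↔ (ξ.2 : ℝ) ≤ rankCDF ξ.1 μ (ξ.1 l) := by
    intro l; simp [admissibleRanks]
  rw [decode, Equiv.symm_apply_eq, Finset.min'_eq_iff, hmem]
  refine and_congr_right fun _ => ⟨fun h l hl => h _ ((hmem l).2 hl), fun h r hr => ?_⟩
  obtain ⟨l, rfl⟩ := ξ.1.surjective r
  exact h l ((hmem l).1 hr)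

theorem measurableSet_decode_eq {V : ℕ} (μ : PMF (Fin V)) (v : Fin V) :
    MeasurableSet {ξ : Key V | decode ξ μ = v} := by
  have h : ∀ l, MeasurableSet {ξ : Key V | (ξ.2 : ℝ) ≤ rankCDF ξ.1 μ (ξ.1 l)} := fun l =>
    measurableSet_le (measurable_subtype_coe.comp measurable_snd)
      ((measurable_of_countable fun π : Equiv.Perm (Fin V) => rankCDF π μ (π l)).comp
        measurable_fst)
  have h' : ∀ l, MeasurableSet {ξ : Key V | ξ.1 v ≤ ξ.1 l} := fun l =>
    (MeasurableSet.of_discrete (s := {π : Equiv.Perm (Fin V) | π v ≤ π l})).preimage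
      measurable_fst
  simp only [decode_eq_iff]
  have : {ξ : Key V | (ξ.2 : ℝ) ≤ rankCDF ξ.1 μ (ξ.1 v) ∧
      ∀ l, (ξ.2 : ℝ) ≤ rankCDF ξ.1 μ (ξ.1 l) → ξ.1 v ≤ ξ.1 l}
      = {ξ : Key V | (ξ.2 : ℝ) ≤ rankCDF ξ.1 μ (ξ.1 v)} ∩
        ⋂ l, ({ξ : Key V | (ξ.2 : ℝ) ≤ rankCDF ξ.1 μ (ξ.1 l)}ᶜ ∪ {ξ : Key V | ξ.1 v ≤ ξ.1 l}) := by
    ext ξ; simp [imp_iff_not_or]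
  rw [this]
  exact (h v).inter (MeasurableSet.iInter fun l => (h l).compl.union (h' l))

/-- The keys which make token `i` equal to `y i`, given that the earlier tokens are those
of `y`. -/
def tokenEvent {V n : ℕ} (p : LanguageModel V) (prompt : List (Fin V)) (y : Fin n → Fin V)
    (i : Fin n) : Set (Key V) :=
  {ξ | decode ξ (p (prompt ++ List.ofFn fun j : Fin i.val => y ⟨j.val, j.isLt.trans i.isLt⟩))
    = y i}

/-- Once the whole text is prescribed, the history of token `i` is read off from `y`, so the
recursion decouples into one condition per key. -/
theorem generate_eq_iff {V n : ℕ} (p : LanguageModel V) (prompt : List (Fin V))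
    (ξ : Fin n → Key V) (y : Fin n → Fin V) :
    generate p prompt ξ = y ↔ ξ ∈ Set.univ.pi (tokenEvent p prompt y) := by
  simp only [Set.mem_univ_pi, tokenEvent, Set.mem_ofPred_eq]
  constructor
  · rintro rfl i
    rw [generate]
  · intro h
    have : ∀ k (i : Fin n), i.val = k → generate p prompt ξ i = y i := by
      intro k
      induction k using Nat.strong_induction_on with
      | _ k ih =>
        rintro i rfl
        rw [generate]
        have hy : (fun j : Fin i.val => generate p prompt ξ ⟨j.val, j.isLt.trans i.isLt⟩)
            = fun j : Fin i.val => y ⟨j.val, j.isLt.trans i.isLt⟩ :=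
          funext fun j => ih j.val j.isLt _ rfl
        rw [hy, h i]
    exact funext fun i => this _ i rfl

theorem measurableSet_tokenEvent {V n : ℕ} (p : LanguageModel V) (prompt : List (Fin V))
    (y : Fin n → Fin V) (i : Fin n) : MeasurableSet (tokenEvent p prompt y i) :=
  measurableSet_decode_eq _ _

/-- Conditioning a product measure on a box conditions each factor. -/
theorem cond_pi_univ_pi {ι : Type*} [Fintype ι] {α : ι → Type*} [∀ i, MeasurableSpace (α i)]
    (μ : ∀ i, Measure (α i)) [∀ i, IsProbabilityMeasure (μ i)] {s : ∀ i, Set (α i)}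
    (hs : ∀ i, MeasurableSet (s i)) :
    (Measure.pi μ)[|Set.univ.pi s] = Measure.pi fun i => (μ i)[|s i] := by
  symm
  refine Measure.pi_eq fun t ht => ?_
  rw [cond_apply (MeasurableSet.univ_pi hs), ← Set.pi_inter_distrib, Measure.pi_pi, Measure.pi_pi,
    ENNReal.prod_inv_distrib, ← Finset.prod_mul_distrib]
  · exact Finset.prod_congr rfl fun i _ => (cond_apply (hs i) _ _).symm
  · intro i _ j _ _
    exact Or.inr (measure_ne_top _ _)

/-! ### Conditional law of the keys given prompt and text -/

namespace Experiment

variable {V : ℕ} (E : Experiment V) (p : LanguageModel V)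

instance instIsProbabilityMeasureProb : IsProbabilityMeasure E.prob := by
  unfold prob; infer_instance

/-- The event that the prompt is `x` and the generated text is `y`. -/
def atom (x : Fin (E.n₀ + 1) → Fin V) (y : Fin E.n → Fin V) : Set E.Sample :=
  {x} ×ˢ ((Set.univ.pi (tokenEvent p (List.ofFn x) y)) ×ˢ Set.univ)

theorem mem_atom_iff {x : Fin (E.n₀ + 1) → Fin V} {y : Fin E.n → Fin V} {ω : E.Sample} :
    ω ∈ E.atom p x y ↔ ω.1 = x ∧ E.text p ω = y := by
  simp only [atom, Set.mem_prod, Set.mem_singleton_iff, Set.mem_univ, and_true,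
    ← generate_eq_iff, text]
  exact and_congr_right fun h => by rw [h]

theorem measurableSet_box (x : Fin (E.n₀ + 1) → Fin V) (y : Fin E.n → Fin V) :
    MeasurableSet (Set.univ.pi (tokenEvent p (List.ofFn x) y)) :=
  MeasurableSet.univ_pi fun _ => measurableSet_tokenEvent _ _ _ _

theorem measurableSet_atom (x : Fin (E.n₀ + 1) → Fin V) (y : Fin E.n → Fin V) :
    MeasurableSet (E.atom p x y) :=
  (measurableSet_singleton x).prod ((E.measurableSet_box p x y).prod MeasurableSet.univ)

theorem measurable_promptText : Measurable fun ω : E.Sample => (ω.1, E.text p ω) := by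
  refine measurable_to_countable' fun z => ?_
  convert E.measurableSet_atom p z.1 z.2 using 1
  ext ω
  rw [mem_atom_iff, Set.mem_preimage, Set.mem_singleton_iff, Prod.ext_iff]

theorem measurable_published : Measurable (E.published p) :=
  (measurable_of_countable fun z : (Fin (E.n₀ + 1) → Fin V) × (Fin E.n → Fin V) =>
    E.edit z.1 z.2).comp (E.measurable_promptText p)

theorem measurable_weights : Measurable (E.weights p) :=
  (measurable_of_countable fun z : (Fin (E.n₀ + 1) → Fin V) × (Fin E.n → Fin V) =>
    E.weight z.1 z.2).comp (E.measurable_promptText p)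

theorem fullInfo_le : E.fullInfo p ≤ inferInstanceAs (MeasurableSpace E.Sample) := by
  rw [← measurable_iff_comap_le]
  have h : @Measurable _ _ _ ⊤ fun z : (Fin (E.n₀ + 1) → Fin V) × (Fin E.n → Fin V) =>
      (E.edit z.1 z.2, z.1, z.2) := @measurable_of_countable _ _ _ ⊤ _ _ _
  exact h.comp (E.measurable_promptText p)

theorem publicInfo_le : E.publicInfo p ≤ inferInstanceAs (MeasurableSpace E.Sample) := by
  rw [← measurable_iff_comap_le]
  have h : @Measurable _ _ _ ⊤ fun z : (Fin (E.n₀ + 1) → Fin V) × (Fin E.n → Fin V) =>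
      (z.1, E.edit z.1 z.2) := @measurable_of_countable _ _ _ ⊤ _ _ _
  exact h.comp (E.measurable_promptText p)

theorem measurable_windowStat {Ω : Type*} [MeasurableSpace Ω] {w : Ω → Fin E.n → ℝ}
    {ξ : Ω → Fin E.n → Key V} {y : Ω → Fin E.m → Fin V} (hw : Measurable w) (hξ : Measurable ξ)
    (hy : Measurable y) (a : Fin (E.n - E.B + 1)) (b : Fin (E.m - E.B + 1)) :
    Measurable fun ω => E.windowStat (w ω) (ξ ω) (y ω) a b := by
  simp only [windowStat, weightedStat_eq, window]
  exact (Finset.measurable_fun_sum _ fun i _ => (hw.eval).mul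
    (measurable_tokenScore_comp hy.eval hξ.eval)).const_mul _

theorem measurable_maxStat {Ω : Type*} [MeasurableSpace Ω] {w : Ω → Fin E.n → ℝ}
    {ξ : Ω → Fin E.n → Key V} {y : Ω → Fin E.m → Fin V} (hw : Measurable w) (hξ : Measurable ξ)
    (hy : Measurable y) : Measurable fun ω => E.maxStat (w ω) (ξ ω) (y ω) := by
  have := Finset.measurable_sup' (Finset.univ_nonempty
      (α := Fin (E.n - E.B + 1) × Fin (E.m - E.B + 1)))
    fun ab _ => E.measurable_windowStat hw hξ hy ab.1 ab.2
  convert this using 1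
  ext ω
  simp [maxStat, Finset.sup'_apply]

/-- The event that the `t`-th fresh key sequence scores at least as high as the true one. -/
def exceedEvent (t : Fin E.T) : Set E.Sample :=
  {ω | E.maxStat (E.weights p ω) ω.2.1 (E.published p ω)
    ≤ E.maxStat (E.weights p ω) (ω.2.2 t) (E.published p ω)}

theorem measurableSet_exceedEvent (t : Fin E.T) : MeasurableSet (E.exceedEvent p t) :=
  measurableSet_le
    (E.measurable_maxStat (E.measurable_weights p) measurable_snd.fst (E.measurable_published p))
    (E.measurable_maxStat (E.measurable_weights p) (measurable_snd.snd.eval)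
      (E.measurable_published p))

/-- The atom is a product set whose key factor is a box, so `cond_pi_univ_pi` identifies the
conditional law of the true keys as a product. -/
theorem prob_atom_inter_key (x : Fin (E.n₀ + 1) → Fin V) (y : Fin E.n → Fin V)
    (F : Set (Fin E.n → Key V)) :
    E.prob (E.atom p x y ∩ {ω | ω.2.1 ∈ F}) = E.prob (E.atom p x y) *
      (Measure.pi fun i => (keyLaw V)[|tokenEvent p (List.ofFn x) y i]) F := by
  have h : E.atom p x y ∩ {ω | ω.2.1 ∈ F} =
      {x} ×ˢ ((Set.univ.pi (tokenEvent p (List.ofFn x) y) ∩ F) ×ˢ Set.univ) := by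
    ext ω
    simp only [atom, Set.mem_inter_iff, Set.mem_prod, Set.mem_ofPred_eq, Set.mem_univ, and_true]
    tauto
  rw [h, atom, prob, ← cond_pi_univ_pi _ fun i => measurableSet_tokenEvent p (List.ofFn x) y i]
  simp only [Measure.prod_prod, measure_univ, mul_one]
  rw [mul_assoc, mul_comm (Measure.pi _ _), cond_mul_eq_inter (E.measurableSet_box p x y)]

theorem prob_atom_inter_fresh (x : Fin (E.n₀ + 1) → Fin V) (y : Fin E.n → Fin V) (t : Fin E.T)
    {G : Set (Fin E.n → Key V)} (hG : MeasurableSet G) :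
    E.prob (E.atom p x y ∩ {ω | ω.2.2 t ∈ G}) = E.prob (E.atom p x y) *
      (Measure.pi fun _ => keyLaw V) G := by
  have h : E.atom p x y ∩ {ω | ω.2.2 t ∈ G} =
      {x} ×ˢ ((Set.univ.pi (tokenEvent p (List.ofFn x) y)) ×ˢ (Function.eval t ⁻¹' G)) := by
    ext ω
    simp only [atom, Set.mem_inter_iff, Set.mem_prod, Set.mem_ofPred_eq, Set.mem_univ, and_true,
      Set.mem_preimage, Function.eval]
    tauto
  rw [h, atom, prob]
  simp only [Measure.prod_prod, measure_univ, mul_one]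
  rw [(measurePreserving_eval (fun _ : Fin E.T => Measure.pi fun _ : Fin E.n => keyLaw V)
    t).measure_preimage hG.nullMeasurableSet, mul_assoc]

theorem isProbabilityMeasure_cond_tokenEvent {x : Fin (E.n₀ + 1) → Fin V} {y : Fin E.n → Fin V}
    (h : E.prob (E.atom p x y) ≠ 0) (i : Fin E.n) :
    IsProbabilityMeasure ((keyLaw V)[|tokenEvent p (List.ofFn x) y i]) := by
  refine cond_isProbabilityMeasure fun h0 => h ?_
  rw [atom, prob, Measure.prod_prod, Measure.prod_prod, Measure.pi_pi,
    Finset.prod_eq_zero (Finset.mem_univ i) h0, zero_mul, mul_zero]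

theorem abs_windowStat_le (hV : 2 ≤ V) {w : Fin E.n → ℝ} {W : ℝ} (hw : ∀ i, |w i| ≤ W)
    (ξ : Fin E.n → Key V) (y : Fin E.m → Fin V) (a : Fin (E.n - E.B + 1))
    (b : Fin (E.m - E.B + 1)) : |E.windowStat w ξ y a b| ≤ W := by
  have hB : (0 : ℝ) < E.B := by exact_mod_cast E.one_le_B
  rw [windowStat, weightedStat_eq, abs_mul, abs_of_pos (by positivity), div_mul_eq_mul_div,
    one_mul, div_le_iff₀ hB]
  refine (Finset.abs_sum_le_sum_abs _ _).trans ?_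
  calc _ ≤ ∑ _i : Fin E.B, W := by
        refine Finset.sum_le_sum fun i _ => ?_
        rw [abs_mul]
        have h1 := abs_tokenScore_le hV (window E.B_le_m b y i) (window E.B_le_n a ξ i)
        have h2 : |window E.B_le_n a w i| ≤ W := hw _
        nlinarith [abs_nonneg (window E.B_le_n a w i),
          abs_nonneg (tokenScore (window E.B_le_m b y i) (window E.B_le_n a ξ i))]
    _ = W * E.B := by simp [mul_comm]

theorem integrable_windowStat (hV : 2 ≤ V) (a : Fin (E.n - E.B + 1)) (b : Fin (E.m - E.B + 1)) :
    Integrable (fun ω => E.windowStat (E.weights p ω) ω.2.1 (E.published p ω) a b) E.prob := by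
  -- There are finitely many prompts and texts, so the weights are bounded.
  obtain ⟨W, hW⟩ := (Set.finite_range fun z : (Fin (E.n₀ + 1) → Fin V) × (Fin E.n → Fin V) × Fin E.n
    => |E.weight z.1 z.2.1 z.2.2|).bddAbove
  refine Integrable.of_bound (E.measurable_windowStat (E.measurable_weights p) measurable_snd.fst
    (E.measurable_published p) a b).aestronglyMeasurable W (ae_of_all _ fun ω => ?_)
  exact E.abs_windowStat_le hV (fun i => hW ⟨(ω.1, E.text p ω, i), rfl⟩) _ _ _ _

/-- On an atom of positive probability, the conditional mean of a window statistic is its mean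
under independent keys, each conditioned on the token it generated. -/
theorem condExp_windowStat_of_mem_atom (hV : 2 ≤ V) {x : Fin (E.n₀ + 1) → Fin V}
    {y : Fin E.n → Fin V} (h : E.prob (E.atom p x y) ≠ 0) (a : Fin (E.n - E.B + 1))
    (b : Fin (E.m - E.B + 1)) {ω : E.Sample} (hω : ω ∈ E.atom p x y) :
    (E.prob[fun ω' => E.windowStat (E.weights p ω') ω'.2.1 (E.published p ω') a b
      | E.fullInfo p]) ω
      = ∫ ξ, E.windowStat (E.weight x y) ξ (E.edit x y) a b
          ∂(Measure.pi fun i => (keyLaw V)[|tokenEvent p (List.ofFn x) y i]) := by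
  set f : E.Sample → ℝ := fun ω' => E.windowStat (E.weights p ω') ω'.2.1 (E.published p ω') a b
  have hA : MeasurableSet[E.fullInfo p] (E.atom p x y) := by
    refine ⟨{z | z.2.1 = x ∧ z.2.2 = y}, trivial, ?_⟩
    ext ω'
    simp [mem_atom_iff]
  have hA' := E.measurableSet_atom p x y
  -- The conditional expectation factors through the conditioning map, which is constant on the
  -- atom. This gives equality at every point of the atom, not just almost everywhere.
  have hconst : ∀ ω' ∈ E.atom p x y, (E.prob[f | E.fullInfo p]) ω' = (E.prob[f | E.fullInfo p]) ω := by
    intro ω' hω'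
    refine Measurable.factorsThrough (mY := ⊤)
      (stronglyMeasurable_condExp (m := E.fullInfo p)).measurable ?_
    rw [mem_atom_iff] at hω hω'
    simp only [published, hω.1, hω.2, hω'.1, hω'.2]
  have h1 : ∫ ω' in E.atom p x y, (E.prob[f | E.fullInfo p]) ω' ∂E.prob
      = ∫ ω' in E.atom p x y, f ω' ∂E.prob :=
    setIntegral_condExp (E.fullInfo_le p) (E.integrable_windowStat p hV a b) hA
  have hf : ∀ ω' ∈ E.atom p x y, f ω' = E.windowStat (E.weight x y) ω'.2.1 (E.edit x y) a b := by
    intro ω' hω'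
    rw [mem_atom_iff] at hω'
    simp only [f, weights, published, hω'.1, hω'.2]
  have hmap : (E.prob.restrict (E.atom p x y)).map (fun ω' => ω'.2.1)
      = E.prob (E.atom p x y) • Measure.pi fun i => (keyLaw V)[|tokenEvent p (List.ofFn x) y i] := by
    ext F hF
    rw [Measure.map_apply measurable_snd.fst hF,
      Measure.restrict_apply (hF.preimage measurable_snd.fst), Set.inter_comm]
    exact E.prob_atom_inter_key p x y F
  rw [setIntegral_congr_fun hA' hconst, setIntegral_congr_fun hA' hf, setIntegral_const,
    ← integral_map (φ := fun ω' : E.Sample => ω'.2.1)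
      (f := fun ξ => E.windowStat (E.weight x y) ξ (E.edit x y) a b)
      measurable_snd.fst.aemeasurable
      (E.measurable_windowStat measurable_const measurable_id
        measurable_const a b).aestronglyMeasurable,
    hmap, integral_smul_measure, smul_eq_mul, smul_eq_mul] at h1
  exact mul_left_cancel₀ (ENNReal.toReal_ne_zero.2 ⟨h, measure_ne_top _ _⟩) h1

/-! ### Tails of the window statistics -/

theorem windowStat_neg (w : Fin E.n → ℝ) (ξ : Fin E.n → Key V) (y : Fin E.m → Fin V)
    (a : Fin (E.n - E.B + 1)) (b : Fin (E.m - E.B + 1)) :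
    E.windowStat (-w) ξ y a b = -E.windowStat w ξ y a b := by
  simp [windowStat, weightedStat_eq, window]

theorem integral_windowStat_keyLaw (hV : 2 ≤ V) (w : Fin E.n → ℝ) (y : Fin E.m → Fin V)
    (a : Fin (E.n - E.B + 1)) (b : Fin (E.m - E.B + 1)) :
    ∫ ξ, E.windowStat w ξ y a b ∂(Measure.pi fun _ => keyLaw V) = 0 := by
  simp only [windowStat, weightedStat_eq, window]
  rw [integral_const_mul, integral_finsetSum]
  · refine mul_eq_zero_of_right _ (Finset.sum_eq_zero fun i _ => ?_)
    rw [integral_const_mul, integral_comp_eval (μ := fun _ : Fin E.n => keyLaw V)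
      (f := tokenScore _)
      (measurable_tokenScore_comp measurable_const measurable_id).aestronglyMeasurable]
    exact mul_eq_zero_of_right _ (integral_tokenScore_keyLaw _)
  · intro i _
    refine Integrable.const_mul ?_ _
    refine Integrable.of_bound (Measurable.aestronglyMeasurable ?_) (1 / 4)
      (ae_of_all _ fun ξ => abs_tokenScore_le hV _ _)
    exact measurable_tokenScore_comp (ξ := fun ξ : Fin E.n → Key V => ξ _) measurable_const
      (measurable_pi_apply _)

/-- The lower tail is the upper tail for the weights `-w`; Hoeffding's bound sees only the squares
of the weights. -/
theorem measure_windowStat_add_le (hV : 2 ≤ V) (μ : Fin E.n → Measure (Key V))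
    [∀ i, IsProbabilityMeasure (μ i)] (w : Fin E.n → ℝ) {W : ℝ} (hW : 0 < W)
    (hw : ∀ i, w i ^ 2 ≤ W) (y : Fin E.m → Fin V) (a : Fin (E.n - E.B + 1))
    (b : Fin (E.m - E.B + 1)) {s : ℝ} (hs : 0 ≤ s) :
    Measure.pi μ {ξ | E.windowStat w ξ y a b + s ≤ ∫ ξ', E.windowStat w ξ' y a b ∂Measure.pi μ}
      ≤ ENNReal.ofReal (Real.exp (-(8 * E.B * s ^ 2 / W))) := by
  have h := weightedStat_tail hV E.one_le_B E.B_le_n μ (-w) hW (by simpa using hw)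
    (window E.B_le_m b y) a hs
  rw [← ofReal_measureReal]
  refine ENNReal.ofReal_le_ofReal (le_trans (le_of_eq ?_) h)
  congr 1
  ext ξ
  have hneg := fun ξ => E.windowStat_neg w ξ y a b
  simp only [windowStat] at hneg
  simp only [Set.mem_ofPred_eq, hneg, integral_neg, windowStat]
  constructor <;> intro h <;> linarith

theorem measure_le_windowStat (hV : 2 ≤ V) (w : Fin E.n → ℝ) {W : ℝ} (hW : 0 < W)
    (hw : ∀ i, w i ^ 2 ≤ W) (y : Fin E.m → Fin V) (a : Fin (E.n - E.B + 1))
    (b : Fin (E.m - E.B + 1)) {s : ℝ} (hs : 0 ≤ s) :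
    (Measure.pi fun _ => keyLaw V) {ξ | s ≤ E.windowStat w ξ y a b}
      ≤ ENNReal.ofReal (Real.exp (-(8 * E.B * s ^ 2 / W))) := by
  have h := weightedStat_tail hV E.one_le_B E.B_le_n (fun _ => keyLaw V) w hW hw
    (window E.B_le_m b y) a hs
  have h0 := E.integral_windowStat_keyLaw hV w y a b
  simp only [windowStat] at h0
  rw [h0] at h
  simp only [zero_add] at h
  rw [← ofReal_measureReal]
  exact ENNReal.ofReal_le_ofReal h

/-! ### Probability that a fresh key sequence beats the true one -/

theorem exp_neg_eight_log_bound {n N : ℕ} (hn : 2 ≤ n) (hN : n ≤ N) :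
    Real.exp (-(8 * Real.log N)) + (N : ℝ) ^ 2 * Real.exp (-(8 * Real.log N)) ≤ 2 / n := by
  have hn0 : (0 : ℝ) < n := by positivity
  have hnN : (n : ℝ) ≤ N := by exact_mod_cast hN
  have hN1 : (1 : ℝ) ≤ N := by exact_mod_cast (by omega : 1 ≤ N)
  have hN0 : (0 : ℝ) < N := by linarith
  have he : Real.exp (-(8 * Real.log N)) = ((N : ℝ) ^ 8)⁻¹ := by
    rw [Real.exp_neg, mul_comm, Real.exp_mul, Real.exp_log hN0]
    norm_cast
  have h1 : ((N : ℝ) ^ 8)⁻¹ ≤ (n : ℝ)⁻¹ :=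
    inv_anti₀ hn0 (hnN.trans (le_self_pow₀ hN1 (by norm_num)))
  have h2 : (N : ℝ) ^ 2 * ((N : ℝ) ^ 8)⁻¹ ≤ (n : ℝ)⁻¹ := by
    have : (N : ℝ) ^ 2 * ((N : ℝ) ^ 8)⁻¹ = ((N : ℝ) ^ 6)⁻¹ := by field_simp
    rw [this]
    exact inv_anti₀ hn0 (hnN.trans (le_self_pow₀ hN1 (by norm_num)))
  rw [he, show (2 : ℝ) / n = (n : ℝ)⁻¹ + (n : ℝ)⁻¹ by ring]
  exact add_le_add h1 h2

theorem prob_atom_inter_exceedEvent_le (hV : 2 ≤ V) (hn : 2 ≤ E.n)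
    {x : Fin (E.n₀ + 1) → Fin V} {y : Fin E.n → Fin V} (hA : E.prob (E.atom p x y) ≠ 0)
    {ω₀ : E.Sample} (hω₀ : ω₀ ∈ E.atom p x y)
    (hgood : 2 < (E.scale p ω₀)⁻¹ * E.maxCondMean p ω₀) (t : Fin E.T) :
    E.prob (E.atom p x y ∩ E.exceedEvent p t)
      ≤ E.prob (E.atom p x y) * ENNReal.ofReal (2 / E.n) := by
  have hprob := E.isProbabilityMeasure_cond_tokenEvent p hA
  set N := max E.n E.m
  set s := E.scale p ω₀ with hs_def
  set W := E.omegaMax p ω₀ with hW_def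
  set μ : Fin E.n → Measure (Key V) := fun i => (keyLaw V)[|tokenEvent p (List.ofFn x) y i]
  have hweights : ∀ ω ∈ E.atom p x y, E.weights p ω = E.weight x y := fun ω hω => by
    rw [mem_atom_iff] at hω
    rw [weights, hω.1, hω.2]
  have hpublished : ∀ ω ∈ E.atom p x y, E.published p ω = E.edit x y := fun ω hω => by
    rw [mem_atom_iff] at hω
    rw [published, hω.1, hω.2]
  -- A vanishing scale has inverse `0`, which makes the normalized mean `0` and contradicts `hgood`.
  have hs : 0 < s := by
    refine lt_of_le_of_ne (mul_nonneg (Real.sqrt_nonneg _) (Real.sqrt_nonneg _)) fun h0 => ?_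
    rw [← h0, inv_zero, zero_mul] at hgood
    linarith
  have hW : 0 < W := by
    by_contra hneg
    rw [hs_def, scale, ← hW_def, Real.sqrt_eq_zero'.2 (not_lt.1 hneg), zero_mul] at hs
    exact lt_irrefl _ hs
  have hw : ∀ i, E.weight x y i ^ 2 ≤ W := fun i => by
    rw [← hweights ω₀ hω₀]
    exact Finset.le_sup' (fun i => E.weights p ω₀ i ^ 2) (Finset.mem_univ i)
  have hB : (0 : ℝ) < E.B := by exact_mod_cast E.one_le_B
  have hlog : 0 ≤ Real.log N := Real.log_natCast_nonneg N
  have hexp : 8 * E.B * s ^ 2 / W = 8 * Real.log N := by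
    rw [hs_def, scale, mul_pow, Real.sq_sqrt hW.le, Real.sq_sqrt (by positivity)]
    field_simp
    rfl
  obtain ⟨⟨a, b⟩, -, hab⟩ := Finset.exists_mem_eq_sup' Finset.univ_nonempty
    (fun ab : Fin (E.n - E.B + 1) × Fin (E.m - E.B + 1) =>
      (E.prob[fun ω' => E.windowStat (E.weights p ω') ω'.2.1 (E.published p ω') ab.1 ab.2
        | E.fullInfo p]) ω₀)
  have hmean : 2 * s < ∫ ξ, E.windowStat (E.weight x y) ξ (E.edit x y) a b ∂Measure.pi μ := by
    rw [← E.condExp_windowStat_of_mem_atom p hV hA a b hω₀, ← hab, ← div_eq_inv_mul] at *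
    exact (lt_div_iff₀ hs).1 hgood
  -- The mean exceeds `2 * s`. Outside `F` the true statistic therefore exceeds `s`, and an
  -- exceedance forces some fresh window into `G`.
  let F : Set (Fin E.n → Key V) := {ξ | E.windowStat (E.weight x y) ξ (E.edit x y) a b + s
    ≤ ∫ ξ', E.windowStat (E.weight x y) ξ' (E.edit x y) a b ∂Measure.pi μ}
  let G : Fin (E.n - E.B + 1) × Fin (E.m - E.B + 1) → Set (Fin E.n → Key V) :=
    fun q => {ξ | s ≤ E.windowStat (E.weight x y) ξ (E.edit x y) q.1 q.2}
  have hGm : ∀ q, MeasurableSet (G q) := fun q =>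
    measurableSet_le measurable_const
      (E.measurable_windowStat measurable_const measurable_id measurable_const _ _)
  have hsub : E.atom p x y ∩ E.exceedEvent p t ⊆ (E.atom p x y ∩ {ω | ω.2.1 ∈ F}) ∪
      ⋃ q ∈ Finset.univ, (E.atom p x y ∩ {ω | ω.2.2 t ∈ G q}) := by
    rintro ω ⟨hω, hex⟩
    by_cases hF : ω.2.1 ∈ F
    · exact Or.inl ⟨hω, hF⟩
    right
    simp only [exceedEvent, Set.mem_ofPred_eq, hweights ω hω, hpublished ω hω] at hex
    obtain ⟨q, -, hq⟩ := Finset.exists_mem_eq_sup' Finset.univ_nonempty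
      (fun ab : Fin (E.n - E.B + 1) × Fin (E.m - E.B + 1) =>
        E.windowStat (E.weight x y) (ω.2.2 t) (E.edit x y) ab.1 ab.2)
    have hle : E.windowStat (E.weight x y) ω.2.1 (E.edit x y) a b
        ≤ E.maxStat (E.weight x y) ω.2.1 (E.edit x y) :=
      Finset.le_sup' (fun ab : Fin (E.n - E.B + 1) × Fin (E.m - E.B + 1) =>
        E.windowStat (E.weight x y) ω.2.1 (E.edit x y) ab.1 ab.2) (Finset.mem_univ (a, b))
    rw [maxStat, maxStat, hq] at hex
    rw [maxStat] at hle
    simp only [F, Set.mem_ofPred_eq, not_le] at hF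
    refine Set.mem_biUnion (Finset.mem_univ q) ⟨hω, ?_⟩
    change s ≤ E.windowStat (E.weight x y) (ω.2.2 t) (E.edit x y) q.1 q.2
    linarith
  set r := Real.exp (-(8 * Real.log N)) with hr
  have hF : Measure.pi μ F ≤ ENNReal.ofReal r := by
    have := E.measure_windowStat_add_le hV μ (E.weight x y) hW hw (E.edit x y) a b hs.le
    rwa [hexp] at this
  have hG : ∀ q, (Measure.pi fun _ => keyLaw V) (G q) ≤ ENNReal.ofReal r := fun q => by
    have := E.measure_le_windowStat hV (E.weight x y) hW hw (E.edit x y) q.1 q.2 hs.le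
    rwa [hexp] at this
  have hcard : (Fintype.card (Fin (E.n - E.B + 1) × Fin (E.m - E.B + 1)) : ENNReal)
      ≤ ENNReal.ofReal ((N : ℝ) ^ 2) := by
    rw [← ENNReal.ofReal_natCast]
    refine ENNReal.ofReal_le_ofReal ?_
    have h1 := E.one_le_B
    have h2 := E.B_le_n
    have h3 := E.B_le_m
    have h4 : E.n - E.B + 1 ≤ N := le_trans (by omega) (le_max_left E.n E.m)
    have h5 : E.m - E.B + 1 ≤ N := le_trans (by omega) (le_max_right E.n E.m)
    rw [Fintype.card_prod, Fintype.card_fin, Fintype.card_fin, sq]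
    exact_mod_cast Nat.mul_le_mul h4 h5
  calc E.prob (E.atom p x y ∩ E.exceedEvent p t)
      ≤ E.prob (E.atom p x y ∩ {ω | ω.2.1 ∈ F}) +
        ∑ q, E.prob (E.atom p x y ∩ {ω | ω.2.2 t ∈ G q}) :=
        (measure_mono hsub).trans ((measure_union_le _ _).trans
          (add_le_add_right (measure_biUnion_finset_le _ _) _))
    _ = E.prob (E.atom p x y) * (Measure.pi μ F + ∑ q, (Measure.pi fun _ => keyLaw V) (G q)) := by
        simp only [E.prob_atom_inter_fresh p x y t (hGm _), E.prob_atom_inter_key p x y F,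
          ← Finset.mul_sum, mul_add, μ]
    _ ≤ E.prob (E.atom p x y) * ENNReal.ofReal (2 / E.n) := by
        gcongr
        calc _ ≤ ENNReal.ofReal r + ENNReal.ofReal ((N : ℝ) ^ 2) * ENNReal.ofReal r := by
              refine add_le_add hF ((Finset.sum_le_sum fun q _ => hG q).trans ?_)
              rw [Finset.sum_const, nsmul_eq_mul, Finset.card_univ]
              gcongr
          _ = ENNReal.ofReal (r + (N : ℝ) ^ 2 * r) := by
              rw [← ENNReal.ofReal_mul (by positivity), ← ENNReal.ofReal_add (by positivity)
                (by positivity)]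
          _ ≤ _ := ENNReal.ofReal_le_ofReal
              (exp_neg_eight_log_bound hn (le_max_left E.n E.m))

/-- The finitely many atoms partition the sample space. One point with large normalized mean in an
atom of positive mass already controls the whole atom. -/
theorem prob_exceedEvent_le (hV : 2 ≤ V) (hn : 2 ≤ E.n) (t : Fin E.T) :
    E.prob (E.exceedEvent p t)
      ≤ E.prob {ω | (E.scale p ω)⁻¹ * E.maxCondMean p ω ≤ 2} + ENNReal.ofReal (2 / E.n) := by
  set H : Set E.Sample := {ω | (E.scale p ω)⁻¹ * E.maxCondMean p ω ≤ 2}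
  have hsub : E.exceedEvent p t ⊆ H ∪ ⋃ z ∈ (Finset.univ : Finset
      ((Fin (E.n₀ + 1) → Fin V) × (Fin E.n → Fin V))),
      ((E.exceedEvent p t \ H) ∩ E.atom p z.1 z.2) := by
    intro ω hω
    by_cases hH : ω ∈ H
    · exact Or.inl hH
    · exact Or.inr (Set.mem_biUnion (Finset.mem_univ (ω.1, E.text p ω))
        ⟨⟨hω, hH⟩, (E.mem_atom_iff p).2 ⟨rfl, rfl⟩⟩)
  have hz : ∀ z : (Fin (E.n₀ + 1) → Fin V) × (Fin E.n → Fin V),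
      E.prob ((E.exceedEvent p t \ H) ∩ E.atom p z.1 z.2)
        ≤ E.prob (E.atom p z.1 z.2) * ENNReal.ofReal (2 / E.n) := by
    intro z
    by_cases hA : E.prob (E.atom p z.1 z.2) = 0
    · rw [measure_mono_null Set.inter_subset_right hA]
      exact zero_le
    rcases Set.eq_empty_or_nonempty ((E.exceedEvent p t \ H) ∩ E.atom p z.1 z.2) with h | h
    · rw [h, measure_empty]
      exact zero_le
    obtain ⟨ω₀, ⟨-, hH⟩, hω₀⟩ := h
    refine (measure_mono ?_).trans
      (E.prob_atom_inter_exceedEvent_le p hV hn hA hω₀ (not_le.1 hH) t)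
    exact fun ω hω => ⟨hω.2, hω.1.1⟩
  have hsum : ∑ z : (Fin (E.n₀ + 1) → Fin V) × (Fin E.n → Fin V), E.prob (E.atom p z.1 z.2)
      ≤ 1 := by
    rw [← measure_biUnion_finset]
    · exact prob_le_one
    · intro z _ z' _ hne
      refine Set.disjoint_left.2 fun ω h h' => hne ?_
      rw [mem_atom_iff] at h h'
      exact Prod.ext (h.1.symm.trans h'.1) (h.2.symm.trans h'.2)
    · exact fun z _ => E.measurableSet_atom p z.1 z.2
  refine (measure_mono hsub).trans ((measure_union_le _ _).trans (add_le_add_right ?_ _))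
  refine (measure_biUnion_finset_le _ _).trans ((Finset.sum_le_sum fun z _ => hz z).trans ?_)
  rw [← Finset.sum_mul]
  exact mul_le_of_le_one_left zero_le hsum

end Experiment

/-! ### From exceedances to conditional power -/

/-- Markov's inequality for the conditional probability of a complement. -/
theorem measureReal_condProb_lt_le {Ω : Type*} {m m₀ : MeasurableSpace Ω} (hm : m ≤ m₀)
    (μ : Measure Ω) [IsProbabilityMeasure μ] {S : Set Ω} (hS : MeasurableSet S) {δ : ℝ}
    (hδ : 0 < δ) : μ.real {ω | (μ⟦S|m⟧) ω < 1 - δ} ≤ μ.real Sᶜ / δ := by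
  have hint : Integrable (S.indicator fun _ => (1 : ℝ)) μ := (integrable_const _).indicator hS
  have hle : ∀ᵐ ω ∂μ, (μ⟦S|m⟧) ω ≤ 1 := by
    have := condExp_mono (m := m) hint (integrable_const (1 : ℝ))
      (ae_of_all _ fun ω => Set.indicator_le_self' (fun _ _ => zero_le_one) ω)
    filter_upwards [this] with ω hω
    simpa [condExp_const hm] using hω
  have hmarkov := mul_meas_ge_le_integral_of_nonneg (μ := μ) (f := fun ω => 1 - (μ⟦S|m⟧) ω)
    (hle.mono fun ω hω => sub_nonneg.2 hω) ((integrable_const _).sub integrable_condExp) δ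
  rw [integral_sub (integrable_const _) integrable_condExp, integral_condExp hm,
    integral_indicator_const _ hS, integral_const, probReal_univ, one_smul, smul_eq_mul, mul_one,
    ← probReal_compl_eq_one_sub hS] at hmarkov
  rw [le_div_iff₀ hδ, mul_comm]
  refine le_trans (mul_le_mul_of_nonneg_left (measureReal_mono fun ω hω => ?_) hδ.le) hmarkov
  simp only [Set.mem_ofPred_eq] at hω ⊢
  linarith

namespace Experiment

variable {V : ℕ} (E : Experiment V) (p : LanguageModel V)

theorem pValue_eq (ω : E.Sample) : E.pValue p ω = 1 / ((E.T : ℝ) + 1) *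
    (1 + ∑ t : Fin E.T, (E.exceedEvent p t).indicator (fun _ => (1 : ℝ)) ω) := by
  classical
  simp only [pValue, exceedEvent, Set.indicator_apply, Set.mem_ofPred_eq]

theorem measurableSet_pValue_le (α : ℝ) : MeasurableSet {ω | E.pValue p ω ≤ α} := by
  simp only [pValue_eq]
  exact measurableSet_le (((Finset.measurable_fun_sum _ fun t _ => measurable_const.indicator
    (E.measurableSet_exceedEvent p t)).const_add _).const_mul _) measurable_const

theorem measureReal_pValue_le_compl_le {α r : ℝ} (hα : 0 < α) (hT : 2 / α ≤ (E.T : ℝ) + 1)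
    (hr : 0 ≤ r) (h : ∀ t, E.prob.real (E.exceedEvent p t) ≤ r) :
    E.prob.real {ω | E.pValue p ω ≤ α}ᶜ ≤ 2 / α * r := by
  have hT0 : (0 : ℝ) < E.T + 1 := by positivity
  have hint : ∀ t, Integrable ((E.exceedEvent p t).indicator fun _ => (1 : ℝ)) E.prob := fun t =>
    (integrable_const _).indicator (E.measurableSet_exceedEvent p t)
  have hmarkov := mul_meas_ge_le_integral_of_nonneg (μ := E.prob)
    (f := fun ω => ∑ t : Fin E.T, (E.exceedEvent p t).indicator (fun _ => (1 : ℝ)) ω)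
    (ae_of_all _ fun ω => Finset.sum_nonneg fun t _ =>
      Set.indicator_nonneg (fun _ _ => zero_le_one) _)
    (integrable_finsetSum _ fun t _ => hint t) (α * (E.T + 1) / 2)
  rw [integral_finsetSum _ fun t _ => hint t] at hmarkov
  simp only [integral_indicator_const _ (E.measurableSet_exceedEvent p _), smul_eq_mul,
    mul_one] at hmarkov
  have hsum : ∑ t, E.prob.real (E.exceedEvent p t) ≤ E.T * r := by
    simpa using Finset.sum_le_sum fun t (_ : t ∈ Finset.univ) => h t
  -- Non-rejection means more than `α (T + 1) - 1` exceedances, and this is at least `α (T + 1) / 2`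
  -- because `α (T + 1) ≥ 2`.
  have hsub : {ω | E.pValue p ω ≤ α}ᶜ ⊆ {ω | α * (E.T + 1) / 2
      ≤ ∑ t : Fin E.T, (E.exceedEvent p t).indicator (fun _ => (1 : ℝ)) ω} := by
    intro ω hω
    simp only [Set.mem_compl_iff, Set.mem_ofPred_eq, not_le, pValue_eq] at hω ⊢
    rw [one_div, ← div_eq_inv_mul, lt_div_iff₀ hT0] at hω
    rw [div_le_iff₀ hα] at hT
    linarith
  have hmono := measureReal_mono (μ := E.prob) hsub
  have hfin : α * (E.T + 1) / 2 * E.prob.real {ω | E.pValue p ω ≤ α}ᶜ ≤ (E.T + 1) * r :=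
    (mul_le_mul_of_nonneg_left hmono (by positivity)).trans
      (hmarkov.trans (hsum.trans (by linarith)))
  rw [div_mul_eq_mul_div, le_div_iff₀ hα]
  have : (E.T + 1 : ℝ) * (E.prob.real {ω | E.pValue p ω ≤ α}ᶜ * α) ≤ (E.T + 1) * (2 * r) := by
    linarith
  exact le_of_mul_le_mul_left this hT0

/-- For small `T` one has `η ≥ 1`, so the threshold is negative and the event is null; otherwise two
applications of Markov's inequality contribute the factors `2 / α` and `1 / δ`. -/
theorem prob_condPower_lt_le (hV : 2 ≤ V) (hn : 2 ≤ E.n) {α δ η : ℝ} (hα : 0 < α) (hδ : 0 < δ)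
    (hη : 0 ≤ η) (hT : (E.T : ℝ) + 1 < 2 / α → 1 ≤ η) :
    E.prob {ω | E.condPower p α ω < 1 - η - δ} ≤ ENNReal.ofReal
      (2 / α * ((E.prob {ω | (E.scale p ω)⁻¹ * E.maxCondMean p ω ≤ 2}).toReal + 2 / E.n) / δ) := by
  rcases lt_or_ge ((E.T : ℝ) + 1) (2 / α) with hlt | hge
  · have h0 : ∀ᵐ ω ∂E.prob, 0 ≤ E.condPower p α ω :=
      condExp_nonneg (ae_of_all _ fun ω => Set.indicator_nonneg (fun _ _ => zero_le_one) ω)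
    have : E.prob {ω | E.condPower p α ω < 1 - η - δ} = 0 := by
      refine measure_mono_null (fun ω hω => ?_) h0
      have := hT hlt
      simp only [Set.mem_compl_iff, Set.mem_ofPred_eq, not_le] at hω ⊢
      linarith
    rw [this]
    exact zero_le
  · rw [← ofReal_measureReal]
    refine ENNReal.ofReal_le_ofReal ?_
    have hex : ∀ t, E.prob.real (E.exceedEvent p t)
        ≤ (E.prob {ω | (E.scale p ω)⁻¹ * E.maxCondMean p ω ≤ 2}).toReal + 2 / E.n := fun t => by
      refine (ENNReal.toReal_mono (by finiteness) (E.prob_exceedEvent_le p hV hn t)).trans ?_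
      rw [ENNReal.toReal_add (by finiteness) (by finiteness),
        ENNReal.toReal_ofReal (by positivity)]
    have h1 := E.measureReal_pValue_le_compl_le p hα hge (by positivity) hex
    have h2 := measureReal_condProb_lt_le (E.publicInfo_le p) E.prob
      (E.measurableSet_pValue_le p α) hδ
    refine (measureReal_mono fun ω hω => ?_).trans
      (h2.trans (div_le_div_of_nonneg_right h1 hδ.le))
    simp only [Set.mem_ofPred_eq] at hω ⊢
    exact lt_of_lt_of_le hω (by linarith)

end Experiment

end ITSWatermark

end

theorem mainTheorem1 :
    ∃ C₀ : ℝ, 0 < C₀ ∧ ∀ α ε : ℝ, 0 < α → α < 1 → 0 < ε →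
      ∃ C₁ : ℝ, 0 < C₁ ∧ (3 * ε < α → C₁ = C₀) ∧
        ∀ (V : ℕ) (_ : 2 ≤ V) (p : ITSWatermark.LanguageModel V)
          (E : ℕ → ITSWatermark.Experiment V),
          Tendsto (fun k => (E k).n) atTop atTop →
          (∀ k, 2 / ε - 1 < ((E k).T : ℝ)) →
          (∀ K : ℝ, Tendsto
            (fun k => (E k).prob {ω | ((E k).scale p ω)⁻¹ * (E k).maxCondMean p ω ≤ K})
            atTop (𝓝 0)) →
          ∀ δ : ℝ, 0 < δ → Tendsto
            (fun k => (E k).prob {ω | (E k).condPower p α ω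
              < 1 - C₁ * Real.exp (-2 * ((E k).T : ℝ) * ε ^ 2) - δ})
            atTop (𝓝 0) := by
  refine ⟨1, one_pos, fun α ε hα _ hε =>
    -- The second value is chosen so that `C₁ exp(-2Tε²) ≥ 1` as soon as `T < 2 / α`.
    ⟨if 3 * ε < α then 1 else Real.exp (4 * ε ^ 2 / α), ?_, fun h => if_pos h, ?_⟩⟩
  · split_ifs <;> positivity
  intro V hV p E hn hT hmean δ hδ
  -- For small `T` the bound is vacuous; this cannot happen when `3 * ε < α`.
  have hvacuous : ∀ k, ((E k).T : ℝ) + 1 < 2 / α →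
      1 ≤ (if 3 * ε < α then 1 else Real.exp (4 * ε ^ 2 / α)) *
        Real.exp (-2 * ((E k).T : ℝ) * ε ^ 2) := by
    intro k hk
    split_ifs with h
    -- Here `ε < α`, so `T + 1 > 2 / ε ≥ 2 / α` contradicts `hk`.
    · have h1 : 2 / α ≤ 2 / ε := by gcongr; linarith
      linarith [hT k]
    · rw [← Real.exp_add, Real.one_le_exp_iff]
      have h1 : 4 * ε ^ 2 / α = 2 * ε ^ 2 * (2 / α) := by ring
      rw [h1]
      nlinarith [sq_nonneg ε]
  have hlim : Tendsto (fun k => ENNReal.ofReal (2 / α *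
      (((E k).prob {ω | ((E k).scale p ω)⁻¹ * (E k).maxCondMean p ω ≤ 2}).toReal
        + 2 / ((E k).n : ℝ)) / δ)) atTop (𝓝 0) := by
    have h1 : Tendsto (fun k => ((E k).prob {ω | ((E k).scale p ω)⁻¹ *
        (E k).maxCondMean p ω ≤ 2}).toReal) atTop (𝓝 0) :=
      -- Only the level `2` of the divergence is needed: one unit of scale for the true keys and one
      -- for the fresh keys.
      (ENNReal.tendsto_toReal ENNReal.zero_ne_top).comp (hmean 2)
    have h2 : Tendsto (fun k => 2 / ((E k).n : ℝ)) atTop (𝓝 0) :=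
      (tendsto_const_div_atTop_nhds_zero_nat 2).comp hn
    have h3 := ENNReal.tendsto_ofReal (((h1.add h2).const_mul (2 / α)).div_const δ)
    simpa using h3
  refine tendsto_of_tendsto_of_tendsto_of_le_of_le' tendsto_const_nhds hlim
    (Eventually.of_forall fun _ => zero_le) ?_
  filter_upwards [hn.eventually_ge_atTop 2] with k hk
  exact (E k).prob_condPower_lt_le p hV hk hα hδ (by split_ifs <;> positivity) (hvacuous k)
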